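/- For a finite graph $G$ and $k,t\in\mathbb N$, let $\mathcal H(G,k,t)$ be the graph whose vertices are the proper $k$-colourings of $G$ (with colours $1,\dots,k$), two distinct colourings being adjacent if they differ on at most $t$ vertices. In a proper $k$-colouring $\tau$ of $G$, a vertex $v$ is called $t$-loose if for every colour $j$ there is a neighbour $\sigma$ of $\tau$ in $\mathcal H(G,k,t)$ with $\sigma(v)=j$, and thawed if for every colour $j$ there is $\sigma$ in the connected component of $\tau$ in $\mathcal H(G,k,1)$ with $\sigma(v)=j$. Theorem. There is an absolute constant $C>0$ such that for every $\varepsilon>0$ there is $k_0$ such that the following holds for all integers $k\ge k_0$ and $\Delta\ge 0$ with $\Delta\le(1-\varepsilon)k\ln k$. For every $\delta>0$ there is $N=N(\varepsilon,k,\Delta,\delta)$ such that, for every $n\ge N$ and every simple graph $G$ on $n$ vertices with maximum degree at most $\Delta$ and girth at least $\ln\ln n$ (forests have infinite girth), a uniformly random proper $k$-colouring $\boldsymbol\sigma$ of $G$ satisfies, with probability at least $1-\delta$: every vertex $v$ of $G$ is both $\lfloor C(\ln n)^2\rfloor$-loose in $\boldsymbol\sigma$ and thawed in $\boldsymbol\sigma$.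 In particular $G$ has a proper $k$-colouring. -/

import Mathlib

/-- The distance-`t` `k`-colouring graph `H(G, k, t)`: its vertices are the proper `k`-colourings
of `G`, two distinct ones being adjacent when their Hamming distance is at most `t`. -/
def colouringGraph {V : Type*} [Fintype V] (G : SimpleGraph V) (k t : ℕ) :
    SimpleGraph (G.Coloring (Fin k)) where
  Adj τ σ := τ ≠ σ ∧ hammingDist (fun v => τ v) (fun v => σ v) ≤ t
  symm := ⟨fun τ σ h => ⟨h.1.symm, by rw [hammingDist_comm]; exact h.2⟩⟩
  loopless := ⟨fun _ h => h.1 rfl⟩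

/-- `v` is `t`-loose in `τ`: every colour occurs at `v` in some neighbour of `τ` in `H(G, k, t)`. -/
def IsLoose {V : Type*} [Fintype V] {G : SimpleGraph V} {k : ℕ} (t : ℕ)
    (τ : G.Coloring (Fin k)) (v : V) : Prop :=
  ∀ j : Fin k, ∃ σ : G.Coloring (Fin k), (colouringGraph G k t).Adj τ σ ∧ σ v = j

/-- `v` is `t`-thawed in `τ`: every colour occurs at `v` in some colouring of the `t`-cluster
(connected component of `H(G, k, t)`) of `τ`. -/
def IsThawedAt {V : Type*} [Fintype V] {G : SimpleGraph V} {k : ℕ} (t : ℕ)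
    (τ : G.Coloring (Fin k)) (v : V) : Prop :=
  ∀ j : Fin k, ∃ σ : G.Coloring (Fin k), (colouringGraph G k t).Reachable τ σ ∧ σ v = j

/-- Thawed means `1`-thawed. -/
def IsThawed {V : Type*} [Fintype V] {G : SimpleGraph V} {k : ℕ}
    (τ : G.Coloring (Fin k)) (v : V) : Prop :=
  IsThawedAt 1 τ v

/-- The probability that a uniformly random proper `k`-colouring of the finite graph `G` has the
property `P` (the value is `0` if `G` has no proper `k`-colouring). -/
noncomputable def colouringProb {V : Type*} [Fintype V] (G : SimpleGraph V) (k : ℕ)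
    (P : G.Coloring (Fin k) → Prop) : ℝ :=
  (Nat.card {σ : G.Coloring (Fin k) // P σ} : ℝ) / (Nat.card (G.Coloring (Fin k)) : ℝ)

/-!
Call a vertex frozen, as seen from a root `v`, if its colour cannot be changed by recolouring it
together with vertices further away from `v`, up to distance `d`. The girth makes the ball around
`v` a tree.

Since `G` is triangle-free and `Δ ≤ (1 - ε) k log k`, on average at least `k ^ (ε / 4)` colours
remain free at a vertex when the rest of the graph is coloured. A frozen vertex at distance `d - 1`
has at most two free colours, which is unlikely, and for a set of such vertices the bounds on the
probabilities multiply. Nearer to `v`, each of the `k - 2` colours other than those of a frozen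
vertex and its parent occurs on a frozen child, so a union bound over the sets of `k - 2` children
raises the probability to the power `k - 2` with every step towards `v`. A neighbour of `v` is thus
frozen with probability at most `exp (-(k - 2) ^ (d - 2))`, which is below `1 / n ^ 2` for some `d`
of order `log log n / log k`, while balls of radius `d` have at most `C (log n) ^ 2` vertices.

Once no neighbour of `v` is frozen, `v` can take any colour by a recolouring inside the ball, and as
the ball is a tree, this recolouring can be performed one vertex at a time.
-/

open Finset

section PartialColourings

variable {V α : Type*} [Fintype α] [DecidableEq α] {G : SimpleGraph V} [DecidableRel G.Adj]
  {W : Finset V} {f g : V → α} {v : V}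

/-- The list of colours still available at `v` when the vertices of `W` are coloured by `f`. -/
def freeColours (G : SimpleGraph V) [DecidableRel G.Adj] (W : Finset V) (f : V → α) (v : V) :
    Finset α :=
  {c | ∀ u ∈ W, G.Adj v u → f u ≠ c}

theorem mem_freeColours {c : α} : c ∈ freeColours G W f v ↔ ∀ u ∈ W, G.Adj v u → f u ≠ c := by
  simp [freeColours]

theorem freeColours_anti {W' : Finset V} (h : W ⊆ W') (f : V → α) (v : V) :
    freeColours G W' f v ⊆ freeColours G W f v :=
  fun _ hc => mem_freeColours.2 fun u hu => mem_freeColours.1 hc u (h hu)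

theorem freeColours_congr (h : ∀ u ∈ W, G.Adj v u → f u = g u) :
    freeColours G W f v = freeColours G W g v := by
  ext c
  simp only [mem_freeColours]
  grind

variable [DecidableEq V]

theorem freeColours_erase (f : V → α) (v : V) :
    freeColours G (W.erase v) f v = freeColours G W f v := by
  ext c
  simp only [mem_freeColours, mem_erase]
  grind [SimpleGraph.irrefl]

theorem freeColours_update (hv : v ∉ W) (f : V → α) (c : α) (u : V) :
    freeColours G W (Function.update f v c) u = freeColours G W f u :=
  freeColours_congr fun _ hx _ => Function.update_of_ne (ne_of_mem_of_not_mem hx hv) _ _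

variable [Fintype V]

/-- The maps `V → α` that properly colour the subgraph induced on `W`. Their values outside `W` are
arbitrary, so that the number of proper colourings of that subgraph is
`#(properOn G α W) / (card α) ^ #Wᶜ`. -/
def properOn (G : SimpleGraph V) [DecidableRel G.Adj] (α : Type*) [Fintype α] [DecidableEq α]
    (W : Finset V) : Finset (V → α) :=
  {f | ∀ x ∈ W, ∀ y ∈ W, G.Adj x y → f x ≠ f y}

theorem mem_properOn : f ∈ properOn G α W ↔ ∀ x ∈ W, ∀ y ∈ W, G.Adj x y → f x ≠ f y := by
  simp [properOn]

theorem properOn_congr (h : ∀ x ∈ W, f x = g x) : f ∈ properOn G α W ↔ g ∈ properOn G α W := by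
  simp only [mem_properOn]
  grind

theorem mem_properOn_insert :
    f ∈ properOn G α (insert v W) ↔ f ∈ properOn G α W ∧ f v ∈ freeColours G W f v := by
  simp only [mem_properOn, mem_freeColours, forall_mem_insert, SimpleGraph.irrefl, G.adj_comm _ v]
  grind

theorem update_mem_properOn (hv : v ∉ W) {c : α} :
    Function.update f v c ∈ properOn G α W ↔ f ∈ properOn G α W :=
  properOn_congr fun _ hx => Function.update_of_ne (ne_of_mem_of_not_mem hx hv) _ _

theorem card_mul_card_properOn_insert (hv : v ∉ W) {Q : (V → α) → Prop} [DecidablePred Q]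
    (hQ : DependsOn Q {v}ᶜ) :
    Fintype.card α * #{f ∈ properOn G α (insert v W) | Q f} =
      ∑ f ∈ properOn G α W with Q f, #(freeColours G W f v) := by
  have hQ' (f : V → α) (c : α) : Q (Function.update f v c) ↔ Q f :=
    iff_of_eq <| hQ fun _ hx => Function.update_of_ne hx _ _
  rw [← card_sigma, mul_comm, ← card_univ, ← card_product]
  -- Exchange the colour of `v` with the extra colour.
  refine card_nbij' (fun p => ⟨Function.update p.1 v p.2, p.1 v⟩)
    (fun p => (Function.update p.1 v p.2, p.1 v)) ?_ ?_ ?_ ?_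
  · rintro ⟨f, c⟩ h
    simp_all [mem_properOn_insert, update_mem_properOn hv, freeColours_update hv]
  · rintro ⟨f, c⟩ h
    simp_all [mem_properOn_insert, update_mem_properOn hv, freeColours_update hv]
  · rintro ⟨f, c⟩ -
    simp
  · rintro ⟨f, c⟩ -
    simp

theorem cast_card_mul_card_properOn_insert (hv : v ∉ W) :
    (Fintype.card α : ℝ) * #(properOn G α (insert v W)) =
      ∑ f ∈ properOn G α W, (#(freeColours G W f v) : ℝ) := by
  have h := card_mul_card_properOn_insert (G := G) (α := α) hv (Q := fun _ => True) fun _ _ _ => rfl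
  simp only [filter_true] at h
  exact_mod_cast h

theorem card_pow_mul_card_properOn_union_le {U : Finset V} (hUW : Disjoint U W) (b : ℕ)
    {Q : (V → α) → Prop} [DecidablePred Q] (hQ : DependsOn Q (U : Set V)ᶜ)
    (hb : ∀ f, Q f → ∀ u ∈ U, #(freeColours G W f u) ≤ b) :
    Fintype.card α ^ #U * #{f ∈ properOn G α (U ∪ W) | Q f} ≤
      b ^ #U * #{f ∈ properOn G α W | Q f} := by
  induction U using Finset.induction_on with
  | empty => simp
  | insert v U hv ih =>
    rw [disjoint_insert_left] at hUW
    have hvW : v ∉ U ∪ W := by simp [hv, hUW.1]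
    have ih := ih hUW.2 (hQ.mono (by simp)) fun f hf u hu => hb f hf u (mem_insert_of_mem hu)
    have hsum : ∑ f ∈ properOn G α (U ∪ W) with Q f, #(freeColours G (U ∪ W) f v) ≤
        b * #{f ∈ properOn G α (U ∪ W) | Q f} := by
      rw [mul_comm, ← smul_eq_mul]
      refine sum_le_card_nsmul _ _ _ fun f hf => ?_
      exact (card_le_card (freeColours_anti subset_union_right f v)).trans
        (hb f (mem_filter.1 hf).2 v (mem_insert_self _ _))
    rw [card_insert_of_notMem hv, insert_union, pow_succ, mul_assoc,
      card_mul_card_properOn_insert hvW (hQ.mono (by simp))]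
    grw [hsum, mul_left_comm, ih, pow_succ', mul_assoc]

theorem pow_mul_card_properOn_union_le [Nonempty α] {U : Finset V} {ℓ : ℝ} (hℓ : 0 ≤ ℓ)
    (hU : ℓ ^ #U * #(properOn G α W) ≤ (Fintype.card α : ℝ) ^ #U * #(properOn G α (U ∪ W)))
    (hUW : Disjoint U W) (b : ℕ) {Q : (V → α) → Prop} [DecidablePred Q]
    (hQ : DependsOn Q (U : Set V)ᶜ) (hb : ∀ f, Q f → ∀ u ∈ U, #(freeColours G W f u) ≤ b) :
    ℓ ^ #U * #{f ∈ properOn G α (U ∪ W) | Q f} ≤ (b : ℝ) ^ #U * #(properOn G α (U ∪ W)) := by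
  have hcount : (Fintype.card α : ℝ) ^ #U * #{f ∈ properOn G α (U ∪ W) | Q f} ≤
      (b : ℝ) ^ #U * #(properOn G α W) := by
    refine (show _ ≤ (b : ℝ) ^ #U * #{f ∈ properOn G α W | Q f} from
      mod_cast card_pow_mul_card_properOn_union_le hUW b hQ hb).trans ?_
    gcongr
    exact filter_subset _ _
  have hα : 0 < (Fintype.card α : ℝ) ^ #U := pow_pos (mod_cast Fintype.card_pos) _
  refine le_of_mul_le_mul_left ?_ hα
  grw [mul_left_comm, hcount, mul_left_comm, hU, mul_left_comm]

/-- On average over the proper colourings of an induced subgraph, at least `ℓ` colours remain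
available at any further vertex. -/
def HasFreeColours (G : SimpleGraph V) [DecidableRel G.Adj] (α : Type*) [Fintype α]
    [DecidableEq α] (ℓ : ℝ) : Prop :=
  ∀ W v, v ∉ W → ℓ * #(properOn G α W) ≤ ∑ f ∈ properOn G α W, (#(freeColours G W f v) : ℝ)

theorem HasFreeColours.pow_mul_card_properOn_le {ℓ : ℝ} (hG : HasFreeColours G α ℓ) (hℓ : 0 ≤ ℓ)
    {U : Finset V} (hUW : Disjoint U W) :
    ℓ ^ #U * #(properOn G α W) ≤ (Fintype.card α : ℝ) ^ #U * #(properOn G α (U ∪ W)) := by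
  induction U using Finset.induction_on with
  | empty => simp
  | insert v U hv ih =>
    rw [disjoint_insert_left] at hUW
    have hvW : v ∉ U ∪ W := by simp [hv, hUW.1]
    rw [card_insert_of_notMem hv, insert_union, pow_succ', pow_succ, mul_assoc, mul_assoc,
      cast_card_mul_card_properOn_insert hvW]
    grw [ih hUW.2, mul_left_comm, hG _ v hvW]

theorem HasFreeColours.card_properOn_pos [Nonempty α] {ℓ : ℝ} (hG : HasFreeColours G α ℓ)
    (hℓ : 0 < ℓ) (W : Finset V) : 0 < #(properOn G α W) := by
  have hempty : 0 < #(properOn G α (∅ : Finset V)) :=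
    card_pos.2 ⟨fun _ => Classical.arbitrary α, by simp [mem_properOn]⟩
  have hle := hG.pow_mul_card_properOn_le hℓ.le (disjoint_empty_right W)
  rw [union_empty] at hle
  have hpos : 0 < (Fintype.card α : ℝ) ^ #W * #(properOn G α W) := hle.trans_lt' (by positivity)
  exact_mod_cast pos_of_mul_pos_right hpos (by positivity)

end PartialColourings

section MissedColours

variable {V α : Type*} [DecidableEq α]

theorem exp_neg_mul_inv_le_one_sub_inv {a T : ℝ} (hT : 0 < T) (ha : T + 1 ≤ a) :
    Real.exp (-((1 + 1 / T) * a⁻¹)) ≤ 1 - a⁻¹ := by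
  have ha1 : 0 < a - 1 := by linarith
  have ha0 : 0 < a := by linarith
  have heq : 1 - a⁻¹ = (a - 1) / a := by field_simp
  have hpos : 0 < 1 - a⁻¹ := heq ▸ div_pos ha1 ha0
  have hcoef : (a - 1)⁻¹ ≤ (1 + 1 / T) * a⁻¹ := by
    rw [one_add_div hT.ne', ← div_eq_mul_inv, div_div, ← one_div,
      div_le_div_iff₀ ha1 (by positivity)]
    linarith
  have hlog : -(a - 1)⁻¹ ≤ Real.log (1 - a⁻¹) := by
    refine (Real.one_sub_inv_le_log_of_pos hpos).trans_eq' ?_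
    rw [heq, inv_div]
    field_simp
    ring
  rw [← Real.le_log_iff_exp_le hpos]
  linarith

variable {N : Finset V} {L : V → Finset α} {T : ℕ}

theorem exp_neg_sum_inv_card_le_prod_erase (hT : 0 < T) {c : α} (hc : ∀ u ∈ N, c ∈ L u → T < #(L u))
    (hL : ∀ u ∈ N, (L u).Nonempty) :
    Real.exp (-((1 + 1 / T) * ∑ u ∈ N with c ∈ L u, (#(L u) : ℝ)⁻¹)) ≤
      ∏ u ∈ N, (#((L u).erase c) / #(L u) : ℝ) := by
  rw [sum_filter, mul_sum, ← sum_neg_distrib, Real.exp_sum]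
  refine prod_le_prod (fun _ _ => (Real.exp_pos _).le) fun u hu => ?_
  have : 0 < #(L u) := (hL u hu).card_pos
  split_ifs with hcu
  · refine (exp_neg_mul_inv_le_one_sub_inv (by positivity) (mod_cast hc u hu hcu)).trans_eq ?_
    rw [cast_card_erase_of_mem hcu]
    field_simp
  · rw [erase_eq_of_notMem hcu, div_self (by positivity)]
    simp

variable [Fintype α]

/-- The probability that independent uniform choices from the lists `L u`, `u ∈ N`, all miss the
colour `c` is the product on the right. -/
theorem sum_piFinset_card_forall_ne [Fintype V] [DecidableEq V] (L : V → Finset α) (N : Finset V) :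
    ∑ f ∈ Fintype.piFinset L, (#{c | ∀ u ∈ N, f u ≠ c} : ℝ) =
      #(Fintype.piFinset L) * ∑ c, ∏ u ∈ N, (#((L u).erase c) / #(L u) : ℝ) := by
  have hmiss (c : α) : {f ∈ Fintype.piFinset L | ∀ u ∈ N, f u ≠ c} =
      Fintype.piFinset fun u => if u ∈ N then (L u).erase c else L u := by
    ext f
    simp only [mem_filter, Fintype.mem_piFinset, ← forall_and]
    grind
  have hlist (u : V) (c : α) : (#(L u) : ℝ) * (#((L u).erase c) / #(L u)) = #((L u).erase c) := by
    rcases (L u).eq_empty_or_nonempty with h | h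
    · simp [h]
    · have := h.card_ne_zero
      field_simp
  have hdouble : ∑ f ∈ Fintype.piFinset L, #{c | ∀ u ∈ N, f u ≠ c} =
      ∑ c, #{f ∈ Fintype.piFinset L | ∀ u ∈ N, f u ≠ c} :=
    sum_card_bipartiteAbove_eq_sum_card_bipartiteBelow fun (f : V → α) c => ∀ u ∈ N, f u ≠ c
  rw [mul_sum, ← Nat.cast_sum, hdouble, Nat.cast_sum]
  refine sum_congr rfl fun c _ => ?_
  rw [hmiss, Fintype.card_piFinset, Fintype.card_piFinset, Nat.cast_prod, Nat.cast_prod,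
    ← Fintype.prod_ite_mem N, ← prod_mul_distrib]
  refine prod_congr rfl fun u _ => ?_
  split_ifs
  · rw [hlist]
  · rw [mul_one]

theorem sum_sum_inv_card_le : ∑ c, ∑ u ∈ N with c ∈ L u, (#(L u) : ℝ)⁻¹ ≤ #N := by
  simp only [sum_filter]
  rw [sum_comm, card_eq_sum_ones, Nat.cast_sum]
  refine sum_le_sum fun u _ => ?_
  simp [sum_ite_mem, mul_inv_le_one]

/-- The bound is affine in the number of small lists, so that it can be averaged. -/
theorem exp_neg_mul_le_sum_prod_erase (hT : 0 < T) (hL : ∀ u ∈ N, (L u).Nonempty) {A : ℝ}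
    (hA : 0 ≤ A) :
    Real.exp (-A) * ((Fintype.card α - T * #{u ∈ N | #(L u) ≤ T}) * (1 + A) - (1 + 1 / T) * #N) ≤
      ∑ c, ∏ u ∈ N, (#((L u).erase c) / #(L u) : ℝ) := by
  let X := {u ∈ N | #(L u) ≤ T}.biUnion L
  let a : α → ℝ := fun c => (1 + 1 / T) * ∑ u ∈ N with c ∈ L u, (#(L u) : ℝ)⁻¹
  have hX : Fintype.card α - T * #{u ∈ N | #(L u) ≤ T} ≤ (#Xᶜ : ℝ) := by
    have hle : #X ≤ #{u ∈ N | #(L u) ≤ T} * T :=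
      card_biUnion_le_card_mul _ _ _ fun u hu => (mem_filter.1 hu).2
    rw [sub_le_iff_le_add, ← card_add_card_compl X, add_comm (#X), mul_comm (T : ℝ)]
    exact_mod_cast Nat.add_le_add_left hle _
  have ha : ∑ c ∈ Xᶜ, a c ≤ (1 + 1 / T) * #N := by
    grw [sum_le_univ_sum_of_nonneg (fun c => by positivity), ← mul_sum, sum_sum_inv_card_le]
  -- The tangent to the convex function `exp (-x)` at `A` lies below its graph.
  have htangent (x : ℝ) : Real.exp (-A) * (1 + A - x) ≤ Real.exp (-x) := by
    rw [show -x = -A + (A - x) by ring, Real.exp_add]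
    gcongr
    linarith [Real.add_one_le_exp (A - x)]
  calc Real.exp (-A) * ((Fintype.card α - T * #{u ∈ N | #(L u) ≤ T}) * (1 + A) - (1 + 1 / T) * #N)
      ≤ Real.exp (-A) * (#Xᶜ * (1 + A) - ∑ c ∈ Xᶜ, a c) := by gcongr
    _ = ∑ c ∈ Xᶜ, Real.exp (-A) * (1 + A - a c) := by
      rw [← mul_sum _ (fun c => 1 + A - a c), sum_sub_distrib, sum_const, nsmul_eq_mul]
    _ ≤ ∑ c ∈ Xᶜ, ∏ u ∈ N, (#((L u).erase c) / #(L u) : ℝ) := by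
      refine sum_le_sum fun c hc => (htangent _).trans (exp_neg_sum_inv_card_le_prod_erase hT ?_ hL)
      intro u hu hcu
      by_contra! h
      exact mem_compl.1 hc (mem_biUnion.2 ⟨u, mem_filter.2 ⟨hu, h⟩, hcu⟩)
    _ ≤ _ := sum_le_univ_sum_of_nonneg fun c => prod_nonneg fun u _ => by positivity

end MissedColours

section Resampling

theorem card_filter_adj_le_degree {V : Type*} [Fintype V] (G : SimpleGraph V)
    [DecidableRel G.Adj] (W : Finset V) (v : V) :
    #{u ∈ W | G.Adj v u} ≤ G.degree v :=
  card_le_card fun u hu => (G.mem_neighborFinset v u).2 (mem_filter.1 hu).2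

theorem sum_le_sum_of_agree {V α : Type*} [Fintype V] [DecidableEq V] [DecidableEq α]
    (P : Finset (V → α)) (N : Finset V) {F H : (V → α) → ℝ}
    (h : ∀ f₀ ∈ P, ∑ f ∈ P with ∀ x ∉ N, f x = f₀ x, F f ≤ ∑ f ∈ P with ∀ x ∉ N, f x = f₀ x, H f) :
    ∑ f ∈ P, F f ≤ ∑ f ∈ P, H f := by
  let r (f : V → α) (x : {x // x ∉ N}) : α := f x
  have hr (f f₀ : V → α) : r f = r f₀ ↔ ∀ x ∉ N, f x = f₀ x := by simp [funext_iff, r]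
  have hmaps (f : V → α) (hf : f ∈ P) : r f ∈ P.image r := mem_image_of_mem r hf
  rw [← sum_fiberwise_of_maps_to hmaps, ← sum_fiberwise_of_maps_to hmaps H]
  refine sum_le_sum fun y hy => ?_
  obtain ⟨f₀, hf₀, rfl⟩ := mem_image.1 hy
  simpa only [hr] using h f₀ hf₀

variable {V α : Type*} [Fintype α] [DecidableEq α] {G : SimpleGraph V} [DecidableRel G.Adj]
  {W N : Finset V} {f f₀ : V → α} {v : V}

theorem freeColours_eq_of_isIndepSet (hN : G.IsIndepSet (N : Set V)) (hff₀ : ∀ x ∉ N, f x = f₀ x)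
    (hv : v ∈ N) : freeColours G W f v = freeColours G W f₀ v :=
  freeColours_congr fun u _ ha => hff₀ u fun hu => hN hv hu ha.ne ha

theorem freeColours_eq_filter_adj (f : V → α) (v : V) :
    freeColours G W f v = ({c | ∀ u ∈ {u ∈ W | G.Adj v u}, f u ≠ c} : Finset α) := by
  ext c
  simp [mem_freeColours]

variable [Fintype V] [DecidableEq V]

theorem freeColours_nonempty (hf : f ∈ properOn G α W) (hv : v ∈ W) :
    (freeColours G W f v).Nonempty :=
  ⟨f v, mem_freeColours.2 fun u hu ha => (mem_properOn.1 hf v hv u hu ha).symm⟩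

theorem properOn_filter_agree_eq_piFinset (hNW : N ⊆ W) (hN : G.IsIndepSet (N : Set V))
    (hf₀ : f₀ ∈ properOn G α W) :
    {f ∈ properOn G α W | ∀ x ∉ N, f x = f₀ x} =
      Fintype.piFinset fun x => if x ∈ N then freeColours G W f₀ x else {f₀ x} := by
  ext f
  have hpi : (f ∈ Fintype.piFinset fun x => if x ∈ N then freeColours G W f₀ x else {f₀ x}) ↔
      (∀ x ∈ N, f x ∈ freeColours G W f₀ x) ∧ ∀ x ∉ N, f x = f₀ x := by
    simp only [Fintype.mem_piFinset, ← forall_and]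
    grind
  rw [mem_filter, hpi, and_congr_left_iff]
  intro hff₀
  refine ⟨fun hf x hx => ?_, fun h => mem_properOn.2 fun x hx y hy ha => ?_⟩
  · rw [← freeColours_eq_of_isIndepSet hN hff₀ hx, mem_freeColours]
    exact fun u hu ha => (mem_properOn.1 hf x (hNW hx) u hu ha).symm
  · by_cases hxN : x ∈ N
    · rw [hff₀ y fun hyN => hN hxN hyN ha.ne ha]
      exact (mem_freeColours.1 (h x hxN) y hy ha).symm
    · by_cases hyN : y ∈ N
      · rw [hff₀ x hxN]
        exact mem_freeColours.1 (h y hyN) x hx ha.symm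
      · rw [hff₀ x hxN, hff₀ y hyN]
        exact mem_properOn.1 hf₀ x hx y hy ha

/-- Conditionally on the colours off `N`, the vertices of `N` receive independent uniform colours
from their lists. -/
theorem sum_card_freeColours_agree (hv : {u ∈ W | G.Adj v u} = N)
    (hN : G.IsIndepSet (N : Set V)) (hf₀ : f₀ ∈ properOn G α W) :
    ∑ f ∈ properOn G α W with ∀ x ∉ N, f x = f₀ x, (#(freeColours G W f v) : ℝ) =
      #{f ∈ properOn G α W | ∀ x ∉ N, f x = f₀ x} *
        ∑ c, ∏ u ∈ N, (#((freeColours G W f₀ u).erase c) / #(freeColours G W f₀ u) : ℝ) := by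
  simp only [freeColours_eq_filter_adj _ v, hv]
  rw [properOn_filter_agree_eq_piFinset (hv ▸ filter_subset _ _) hN hf₀,
    sum_piFinset_card_forall_ne]
  congr! 3 with c - u hu
  all_goals rw [if_pos hu]

theorem sum_exp_neg_mul_le_sum_card_freeColours (hv : {u ∈ W | G.Adj v u} = N)
    (hN : G.IsIndepSet (N : Set V)) {T : ℕ} (hT : 0 < T) {A : ℝ} (hA : 0 ≤ A) :
    ∑ f ∈ properOn G α W, Real.exp (-A) *
        ((Fintype.card α - T * #{u ∈ N | #(freeColours G W f u) ≤ T}) * (1 + A)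
          - (1 + 1 / T) * #N) ≤
      ∑ f ∈ properOn G α W, (#(freeColours G W f v) : ℝ) := by
  refine sum_le_sum_of_agree _ N fun f₀ hf₀ => ?_
  have hsmall : ∀ f ∈ {f ∈ properOn G α W | ∀ x ∉ N, f x = f₀ x},
      {u ∈ N | #(freeColours G W f u) ≤ T} = {u ∈ N | #(freeColours G W f₀ u) ≤ T} :=
    fun f hf => filter_congr fun u hu => by
      rw [freeColours_eq_of_isIndepSet hN (mem_filter.1 hf).2 hu]
  have hNW : N ⊆ W := hv ▸ filter_subset _ _
  rw [sum_card_freeColours_agree hv hN hf₀, sum_congr rfl fun f hf => by rw [hsmall f hf],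
    sum_const, nsmul_eq_mul]
  gcongr
  exact exp_neg_mul_le_sum_prod_erase hT (fun u hu => freeColours_nonempty hf₀ (hNW hu)) hA

theorem mul_card_small_freeColours_le [Nonempty α] {ℓ : ℝ} (hℓ : 0 ≤ ℓ) (hv : v ∈ W) (T : ℕ)
    (h : ℓ * #(properOn G α (W.erase v)) ≤ Fintype.card α * #(properOn G α W)) :
    ℓ * #{f ∈ properOn G α W | #(freeColours G W f v) ≤ T} ≤ T * #(properOn G α W) := by
  have hU : {v} ∪ W.erase v = W := by rw [← insert_eq, insert_erase hv]
  have hQ : DependsOn (fun f : V → α => #(freeColours G W f v) ≤ T) ((({v} : Finset V) : Set V)ᶜ) :=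
    fun f g hfg => by
      dsimp only
      rw [freeColours_congr fun u _ ha => hfg (i := u) (by simpa using ha.ne')]
  have := pow_mul_card_properOn_union_le (G := G) (U := {v}) (W := W.erase v) hℓ
    (by simpa [hU] using h) (by simp) T hQ fun f hf u hu => by
      rw [mem_singleton.1 hu, freeColours_erase]
      exact hf
  simpa [hU] using this

theorem mul_sum_card_small_freeColours_le [Nonempty α] {ℓ : ℝ} (hℓ : 0 ≤ ℓ) (hNW : N ⊆ W) (T : ℕ)
    (h : ∀ u ∈ N, ℓ * #(properOn G α (W.erase u)) ≤ Fintype.card α * #(properOn G α W)) :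
    ℓ * ∑ f ∈ properOn G α W, (#{u ∈ N | #(freeColours G W f u) ≤ T} : ℝ) ≤
      #N * (T * #(properOn G α W)) := by
  have hdouble : ∑ f ∈ properOn G α W, #{u ∈ N | #(freeColours G W f u) ≤ T} =
      ∑ u ∈ N, #{f ∈ properOn G α W | #(freeColours G W f u) ≤ T} :=
    sum_card_bipartiteAbove_eq_sum_card_bipartiteBelow fun f u => #(freeColours G W f u) ≤ T
  rw [← Nat.cast_sum, hdouble, Nat.cast_sum, mul_sum, ← nsmul_eq_mul]
  exact sum_le_card_nsmul _ _ _ fun u hu => mul_card_small_freeColours_le hℓ (hNW hu) T (h u hu)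

variable [Nonempty α] {ℓ : ℝ} {T D : ℕ}

theorem mul_card_properOn_le_sum_card_freeColours (hv : {u ∈ W | G.Adj v u} = N)
    (hN : G.IsIndepSet (N : Set V)) (hND : #N ≤ D) (hT : 0 < T) (hℓ : 0 < ℓ)
    (hκ : 0 < Fintype.card α - T ^ 2 * D / ℓ)
    (hℓκ : ℓ ≤ (Fintype.card α - T ^ 2 * D / ℓ) *
      Real.exp (-((1 + 1 / T) * D / (Fintype.card α - T ^ 2 * D / ℓ))))
    (h : ∀ u ∈ N, ℓ * #(properOn G α (W.erase u)) ≤ Fintype.card α * #(properOn G α W)) :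
    ℓ * #(properOn G α W) ≤ ∑ f ∈ properOn G α W, (#(freeColours G W f v) : ℝ) := by
  set κ : ℝ := Fintype.card α - T ^ 2 * D / ℓ with hκ_def
  set A : ℝ := (1 + 1 / T) * D / κ with hA
  set P := properOn G α W
  have hNW : N ⊆ W := hv ▸ filter_subset _ _
  have hsmall : (T : ℝ) * ∑ f ∈ P, (#{u ∈ N | #(freeColours G W f u) ≤ T} : ℝ) ≤
      T ^ 2 * D / ℓ * #P := by
    rw [div_mul_eq_mul_div, le_div_iff₀' hℓ]
    grw [mul_left_comm, mul_sum_card_small_freeColours_le hℓ.le hNW T h, hND]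
    exact le_of_eq (by ring)
  have hκA : κ * A = (1 + 1 / T) * D := by
    rw [hA]
    field_simp
  calc ℓ * #P ≤ Real.exp (-A) * ((κ * #P) * (1 + A) - (1 + 1 / T) * D * #P) := by
        rw [show (κ * #P) * (1 + A) - (1 + 1 / T) * D * #P = κ * #P by rw [← hκA]; ring]
        grw [hℓκ]
        exact le_of_eq (by ring)
    _ ≤ Real.exp (-A) * ((Fintype.card α * #P -
          T * ∑ f ∈ P, (#{u ∈ N | #(freeColours G W f u) ≤ T} : ℝ)) * (1 + A) -
          (1 + 1 / T) * #N * #P) := by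
        grw [hsmall, hND, hκ_def, sub_mul]
    _ = _ := by
        rw [← mul_sum, sum_sub_distrib, ← sum_mul, sum_sub_distrib, ← mul_sum]
        simp only [sum_const, nsmul_eq_mul]
        ring
    _ ≤ _ := sum_exp_neg_mul_le_sum_card_freeColours hv hN hT (by positivity)

theorem hasFreeColours_of_cliqueFree_three (hG : G.CliqueFree 3) (hD : ∀ v, G.degree v ≤ D)
    (hT : 0 < T) (hℓ : 0 < ℓ) (hκ : 0 < Fintype.card α - T ^ 2 * D / ℓ)
    (hℓκ : ℓ ≤ (Fintype.card α - T ^ 2 * D / ℓ) *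
      Real.exp (-((1 + 1 / T) * D / (Fintype.card α - T ^ 2 * D / ℓ)))) :
    HasFreeColours G α ℓ := by
  intro W v hv
  induction hn : #W using Nat.strong_induction_on generalizing W v with
  | _ n ih =>
    refine mul_card_properOn_le_sum_card_freeColours rfl
      ((SimpleGraph.isIndepSet_neighborSet_of_triangleFree G hG v).mono fun u hu => ?_)
      ((card_filter_adj_le_degree G W v).trans (hD v)) hT hℓ hκ hℓκ fun u hu => ?_
    · exact (mem_filter.1 hu).2
    · have hu : u ∈ W := (mem_filter.1 hu).1
      conv_rhs => rw [← insert_erase hu, cast_card_mul_card_properOn_insert (notMem_erase u W)]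
      exact ih _ (hn ▸ card_erase_lt_of_mem hu) (W.erase u) u (notMem_erase u W) rfl

end Resampling

section ManyFreeColours

open Filter

theorem mul_le_sub_div_rpow {ε k D T : ℝ} (hk : 0 < k) (hD : D ≤ k * Real.log k)
    (hlog : T ^ 2 * Real.log k ≤ ε / 8 * k ^ (ε / 4)) :
    (1 - ε / 8) * k ≤ k - T ^ 2 * D / k ^ (ε / 4) := by
  have : T ^ 2 * D / k ^ (ε / 4) ≤ ε / 8 * k := by
    rw [div_le_iff₀ (by positivity)]
    calc T ^ 2 * D ≤ T ^ 2 * (k * Real.log k) := by gcongr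
      _ = k * (T ^ 2 * Real.log k) := by ring
      _ ≤ k * (ε / 8 * k ^ (ε / 4)) := by gcongr
      _ = ε / 8 * k * k ^ (ε / 4) := by ring
  linarith

/-- The exponent `(1 + 1 / T) * D / κ` is at most `(1 - ε / 2) * log k`, so that the right-hand side
is at least `k ^ (ε / 2) / 2`. -/
theorem rpow_le_mul_exp_neg {ε k D T κ : ℝ} (hε : 0 < ε) (hε1 : ε ≤ 1) (hk : 1 < k)
    (hκ : (1 - ε / 8) * k ≤ κ) (hD : D ≤ (1 - ε) * k * Real.log k) (hT : 8 / ε ≤ T)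
    (hℓ : 2 ≤ k ^ (ε / 4)) : k ^ (ε / 4) ≤ κ * Real.exp (-((1 + 1 / T) * D / κ)) := by
  have hk0 : 0 < k := by linarith
  have hT0 : 0 < T := hT.trans_lt' (by positivity)
  have hlog0 : 0 < Real.log k := Real.log_pos hk
  have hκ0 : 0 < κ := by nlinarith
  have hexponent : (1 + 1 / T) * D / κ ≤ (1 - ε / 2) * Real.log k := by
    have hTε : 1 / T ≤ ε / 8 := by
      rw [one_div, inv_le_comm₀ hT0 (by positivity), inv_div]
      exact hT
    rw [div_le_iff₀ hκ0]
    calc (1 + 1 / T) * D ≤ (1 + 1 / T) * ((1 - ε) * k * Real.log k) := by gcongr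
      _ ≤ (1 + ε / 8) * ((1 - ε) * k * Real.log k) := by gcongr
      _ = (1 + ε / 8) * (1 - ε) * (k * Real.log k) := by ring
      _ ≤ (1 - ε / 2) * (1 - ε / 8) * (k * Real.log k) := by
          gcongr ?_ * _
          nlinarith
      _ = (1 - ε / 2) * Real.log k * ((1 - ε / 8) * k) := by ring
      _ ≤ (1 - ε / 2) * Real.log k * κ := by
          gcongr
          exact mul_nonneg (by linarith) hlog0.le
  have hsq : k ^ (ε / 4) * k ^ (ε / 4) = k * Real.exp (-((1 - ε / 2) * Real.log k)) := by
    rw [← Real.rpow_add hk0, Real.rpow_def_of_pos hk0]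
    nth_rw 2 [← Real.exp_log hk0]
    rw [← Real.exp_add]
    ring_nf
  calc k ^ (ε / 4) ≤ k ^ (ε / 4) * k ^ (ε / 4) / 2 := by nlinarith
    _ = k / 2 * Real.exp (-((1 - ε / 2) * Real.log k)) := by rw [hsq]; ring
    _ ≤ κ * Real.exp (-((1 + 1 / T) * D / κ)) := by
        gcongr
        nlinarith

theorem eventually_log_pow_le_rpow (r : ℕ) {c s : ℝ} (hc : 0 < c) (hs : 0 < s) :
    ∀ᶠ k : ℕ in atTop, Real.log k ^ r ≤ c * (k : ℝ) ^ s := by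
  have h := (isLittleO_log_rpow_rpow_atTop r hs).bound hc
  filter_upwards [tendsto_natCast_atTop_atTop.eventually h] with k hk
  rw [Real.norm_of_nonneg (by positivity : (0 : ℝ) ≤ (k : ℝ) ^ s), Real.rpow_natCast] at hk
  exact (le_abs_self _).trans hk

theorem eventually_le_rpow (c : ℝ) {s : ℝ} (hs : 0 < s) : ∀ᶠ k : ℕ in atTop, c ≤ (k : ℝ) ^ s :=
  ((tendsto_rpow_atTop hs).comp tendsto_natCast_atTop_atTop).eventually_ge_atTop c

theorem eventually_hasFreeColours {ε : ℝ} (hε : 0 < ε) :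
    ∀ᶠ k : ℕ in atTop, ∀ Δ : ℕ, (Δ : ℝ) ≤ (1 - ε) * k * Real.log k →
      ∀ {V : Type*} [Fintype V] [DecidableEq V] (G : SimpleGraph V) [DecidableRel G.Adj],
        G.CliqueFree 3 → (∀ v, G.degree v ≤ Δ) → HasFreeColours G (Fin k) ((k : ℝ) ^ (ε / 4)) := by
  set T := ⌈8 / ε⌉₊
  have hT : 0 < T := Nat.ceil_pos.2 (by positivity)
  filter_upwards [eventually_log_pow_le_rpow 1 (c := ε / 8 / T ^ 2) (by positivity)
    (show 0 < ε / 4 by positivity), eventually_le_rpow 2 (show 0 < ε / 4 by positivity),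
    eventually_gt_atTop 1] with k hlog hℓ hk Δ hΔ V _ _ G _ hG hdeg
  have hk' : (1 : ℝ) < k := mod_cast hk
  have hε1 : ε ≤ 1 := by
    by_contra! h
    have : 0 < k * Real.log k := mul_pos (by linarith) (Real.log_pos hk')
    nlinarith [(Nat.cast_nonneg Δ : (0 : ℝ) ≤ Δ)]
  have hTlog : (T : ℝ) ^ 2 * Real.log k ≤ ε / 8 * (k : ℝ) ^ (ε / 4) := by
    rw [pow_one, div_mul_eq_mul_div, le_div_iff₀' (by positivity)] at hlog
    exact hlog
  have hΔk : (Δ : ℝ) ≤ k * Real.log k := hΔ.trans <| by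
    rw [mul_assoc]
    exact mul_le_of_le_one_left (by positivity) (by linarith)
  have hκ := mul_le_sub_div_rpow (by linarith) hΔk hTlog
  have hℓκ := rpow_le_mul_exp_neg hε hε1 hk' hκ hΔ (Nat.le_ceil _) hℓ
  have : Nonempty (Fin k) := ⟨⟨0, by lia⟩⟩
  exact hasFreeColours_of_cliqueFree_three hG hdeg hT (by positivity)
    (by simpa using hκ.trans_lt' (mul_pos (by linarith) (by linarith))) (by simpa using hℓκ)

end ManyFreeColours

section TreeLevels

variable {V : Type*} {G : SimpleGraph V} {d : ℕ} {v u a b x : V}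

/-- Up to level `d`, the function `h` behaves like the distance from the root `v` of a tree. This is
all that the recolouring and counting arguments use of the distance in a graph of large girth. -/
structure IsTreeLevel (G : SimpleGraph V) (h : V → ℕ) (v : V) (d : ℕ) : Prop where
  eq_zero_iff : ∀ x, h x = 0 ↔ x = v
  adj : ∀ u w, G.Adj u w → h u ≤ d → h w = h u + 1 ∨ h w + 1 = h u
  lower_unique : ∀ u p q, h u ≤ d → G.Adj u p → G.Adj u q → h p < h u → h q < h u → p = q
  exists_lower : ∀ u, 0 < h u → h u ≤ d → ∃ p, G.Adj u p ∧ h p + 1 = h u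

theorem IsTreeLevel.card_le [Fintype V] [DecidableRel G.Adj] {h : V → ℕ}
    (ht : IsTreeLevel G h v d) {D : ℕ} (hD : ∀ x, G.degree x ≤ D) {i : ℕ} (hi : i ≤ d) :
    #{x | h x ≤ i} ≤ (D + 1) ^ i := by
  classical
  induction i with
  | zero =>
    rw [pow_zero]
    exact card_le_one.2 (by simp [ht.eq_zero_iff])
  | succ i ih =>
    have hcover : ({x | h x ≤ i + 1} : Finset V) ⊆
        ({x | h x ≤ i} : Finset V).biUnion fun x => insert x (G.neighborFinset x) := by
      intro x hx
      simp only [mem_filter_univ, mem_biUnion, mem_insert, SimpleGraph.mem_neighborFinset] at hx ⊢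
      by_cases hxi : h x ≤ i
      · exact ⟨x, hxi, .inl rfl⟩
      · obtain ⟨p, hp, hpx⟩ := ht.exists_lower x (by lia) (by lia)
        exact ⟨p, by lia, .inr hp.symm⟩
    calc #{x | h x ≤ i + 1} ≤ #{x | h x ≤ i} * (D + 1) :=
          (card_le_card hcover).trans <| card_biUnion_le_card_mul _ _ _ fun x _ =>
            (card_insert_le _ _).trans (Nat.add_le_add_right (hD x) 1)
      _ ≤ (D + 1) ^ (i + 1) := Nat.mul_le_mul_right _ (ih (by lia))

theorem exists_isPath_penultimate_eq (ha : G.Adj a u) (hr : G.Reachable v a)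
    (hd : G.dist v a ≤ G.dist v u) :
    ∃ p : G.Walk v u, p.IsPath ∧ p.length = G.dist v a + 1 ∧ p.penultimate = a := by
  classical
  obtain ⟨p, hp, hl⟩ := hr.exists_path_of_dist
  refine ⟨p.concat ha, hp.concat (fun hu => ?_) ha, by simp [hl], p.penultimate_concat ha⟩
  have hlt := p.length_takeUntil_lt_length hu ha.ne'
  have hle := SimpleGraph.dist_le (p.takeUntil u hu)
  lia

theorem egirth_le_of_adj_of_adj (ha : G.Adj a u) (hb : G.Adj b u) (hab : a ≠ b)
    (hr : G.Reachable v u) (hda : G.dist v a ≤ G.dist v u) (hdb : G.dist v b ≤ G.dist v u) :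
    G.egirth ≤ (2 * G.dist v u + 2 : ℕ) := by
  obtain ⟨p, hp, hpl, rfl⟩ := exists_isPath_penultimate_eq ha (hr.trans ha.symm.reachable) hda
  obtain ⟨q, hq, hql, rfl⟩ := exists_isPath_penultimate_eq hb (hr.trans hb.symm.reachable) hdb
  obtain ⟨w, -, -, c, hc, hcl⟩ := hp.exists_isCycle_length_le_add_of_ne hq
    fun hpq => hab (congrArg _ hpq)
  exact (SimpleGraph.egirth_le_length hc).trans (by exact_mod_cast by lia)

theorem exists_adj_dist_add_one_eq (hr : G.Reachable v u) (h : 0 < G.dist v u) :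
    ∃ p, G.Adj u p ∧ G.dist v p + 1 = G.dist v u := by
  obtain ⟨w, hw⟩ := hr.symm.exists_walk_length_eq_dist
  rw [SimpleGraph.dist_comm] at hw
  cases w with
  | nil => simp at h
  | @cons _ p _ ha q =>
    refine ⟨p, ha, ?_⟩
    rw [SimpleGraph.Walk.length_cons] at hw
    have hle := SimpleGraph.dist_le q
    rw [SimpleGraph.dist_comm] at hle
    rcases ha.diff_dist_adj (u := v) with h | h | h <;> lia

theorem eq_of_adj_of_dist_le (hg : ((2 * d + 2 : ℕ) : ℕ∞) < G.egirth) (hr : G.Reachable v u)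
    (hu : G.dist v u ≤ d) (ha : G.Adj u a) (hb : G.Adj u b) (hda : G.dist v a ≤ G.dist v u)
    (hdb : G.dist v b ≤ G.dist v u) : a = b := by
  by_contra hab
  refine hg.not_ge ((egirth_le_of_adj_of_adj ha.symm hb.symm hab hr hda hdb).trans ?_)
  gcongr

theorem dist_ne_of_adj_of_lt_egirth (hg : ((2 * d + 2 : ℕ) : ℕ∞) < G.egirth)
    (hr : G.Reachable v u) (hu : G.dist v u ≤ d) (ha : G.Adj u a) : G.dist v a ≠ G.dist v u := by
  intro heq
  rcases Nat.eq_zero_or_pos (G.dist v u) with h0 | h0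
  · exact ha.ne (((hr.dist_eq_zero_iff.1 h0).symm).trans
      ((hr.trans ha.reachable).dist_eq_zero_iff.1 (heq.trans h0)))
  · obtain ⟨p, hp, hpu⟩ := exists_adj_dist_add_one_eq hr h0
    have := eq_of_adj_of_dist_le hg hr hu ha hp heq.le (by lia)
    subst this
    lia

open Classical in
/-- The distance from `v`, with the value `d + 1` rather than Mathlib's `0` outside the component of
`v`. -/
noncomputable def level (G : SimpleGraph V) (d : ℕ) (v x : V) : ℕ :=
  if G.Reachable v x then G.dist v x else d + 1

theorem level_of_reachable (hr : G.Reachable v x) : level G d v x = G.dist v x :=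
  if_pos hr

theorem level_eq_zero_iff : level G d v x = 0 ↔ x = v := by
  by_cases hr : G.Reachable v x
  · rw [level_of_reachable hr, hr.dist_eq_zero_iff, eq_comm]
  · simp only [level, hr, if_false, Nat.add_eq_zero_iff, one_ne_zero, and_false, false_iff]
    rintro rfl
    exact hr .rfl

theorem reachable_of_level_le (h : level G d v x ≤ d) : G.Reachable v x := by
  by_contra hr
  simp [level, hr] at h

theorem level_comm (d : ℕ) (v x : V) : level G d v x = level G d x v := by
  rw [level, level, SimpleGraph.dist_comm, SimpleGraph.reachable_comm]

theorem isTreeLevel_level (hg : ((2 * d + 2 : ℕ) : ℕ∞) < G.egirth) (v : V) :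
    IsTreeLevel G (level G d v) v d where
  eq_zero_iff _ := level_eq_zero_iff
  adj u w ha hu := by
    have hr := reachable_of_level_le hu
    rw [level_of_reachable hr] at hu ⊢
    rw [level_of_reachable (hr.trans ha.reachable)]
    have hne := dist_ne_of_adj_of_lt_egirth hg hr hu ha
    rcases ha.diff_dist_adj (u := v) with h | h | h <;> lia
  lower_unique u p q hu hp hq hpu hqu := by
    have hr := reachable_of_level_le hu
    rw [level_of_reachable hr] at hu hpu hqu
    rw [level_of_reachable (hr.trans hp.reachable)] at hpu
    rw [level_of_reachable (hr.trans hq.reachable)] at hqu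
    exact eq_of_adj_of_dist_le hg hr hu hp hq hpu.le hqu.le
  exists_lower u h0 hu := by
    have hr := reachable_of_level_le hu
    rw [level_of_reachable hr] at h0 ⊢
    obtain ⟨p, hp, hpu⟩ := exists_adj_dist_add_one_eq hr h0
    exact ⟨p, hp, by rw [level_of_reachable (hr.trans hp.reachable), hpu]⟩

theorem cliqueFree_three_of_lt_egirth (hg : 3 < G.egirth) : G.CliqueFree 3 := by
  intro s hs
  obtain ⟨u, w, hw, hw3⟩ := SimpleGraph.is3Clique_iff_exists_cycle_length_three.1 ⟨s, hs⟩
  exact hg.not_ge ((SimpleGraph.egirth_le_length hw).trans_eq (by rw [hw3]; rfl))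

end TreeLevels

section Recolouring

variable {V α : Type*} {G : SimpleGraph V} {h : V → ℕ} {d : ℕ} {v u : V} {j : α}

/-- The vertex `u` can be given the colour `c` in the colouring `f` by recolouring vertices of level
at least `h u` and less than `d`: the upper neighbours of colour `c` are first recoloured in the
same manner, while the lower neighbours are left alone. -/
inductive IsRecolourableTo (G : SimpleGraph V) (h : V → ℕ) (d : ℕ) (f : V → α) : V → α → Prop
  | intro (u : V) (c : α) (c' : V → α) (lt : h u < d) (ne : c ≠ f u)
      (ne_lower : ∀ p, G.Adj u p → h p < h u → c ≠ f p)
      (upper : ∀ w, G.Adj u w → h u < h w → f w = c → IsRecolourableTo G h d f w (c' w)) :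
      IsRecolourableTo G h d f u c

theorem IsRecolourableTo.lt {f : V → α} (hu : IsRecolourableTo G h d f u j) : h u < d := by
  cases hu; assumption

theorem IsRecolourableTo.ne {f : V → α} (hu : IsRecolourableTo G h d f u j) : j ≠ f u := by
  cases hu; assumption

theorem IsRecolourableTo.ne_lower {f : V → α} (hu : IsRecolourableTo G h d f u j) :
    ∀ p, G.Adj u p → h p < h u → j ≠ f p := by
  cases hu; assumption

theorem IsRecolourableTo.upper {f : V → α} (hu : IsRecolourableTo G h d f u j) {w : V}
    (ha : G.Adj u w) (hlt : h u < h w) (hw : f w = j) : ∃ b, IsRecolourableTo G h d f w b := by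
  cases hu with
  | intro _ _ c' _ _ _ upper => exact ⟨c' w, upper w ha hlt hw⟩

/-- No colour other than its own can be given to `u` without touching vertices of level less than
`h u` or at least `d`. -/
def IsFrozen (G : SimpleGraph V) (h : V → ℕ) (d : ℕ) (f : V → α) (u : V) : Prop :=
  ∀ c, ¬ IsRecolourableTo G h d f u c

theorem isRecolourableTo_of_forall_not_isFrozen {f : V → α} {c : α} (hd : h u < d) (hc : c ≠ f u)
    (hlow : ∀ p, G.Adj u p → h p < h u → c ≠ f p)
    (hup : ∀ w, G.Adj u w → h u < h w → f w = c → ¬ IsFrozen G h d f w) :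
    IsRecolourableTo G h d f u c := by
  have hcol : ∀ w, ∃ c', G.Adj u w → h u < h w → f w = c → IsRecolourableTo G h d f w c' := by
    intro w
    by_cases hw : IsFrozen G h d f w
    · exact ⟨c, fun ha hlt hwc => absurd hw (hup w ha hlt hwc)⟩
    · obtain ⟨c', hc'⟩ := not_forall_not.1 hw
      exact ⟨c', fun _ _ _ => hc'⟩
  choose c' hc' using hcol
  exact .intro u c c' hd hc hlow hc'

/-- A set `R` of vertices and new colours `c` for them such that recolouring the vertices of `R` one
at a time in order of decreasing level passes through proper colourings only. -/
structure IsRecolouringPlan (G : SimpleGraph V) (h : V → ℕ) (σ : G.Coloring α) (R : Set V)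
    (c : V → α) : Prop where
  level_ne : ∀ u ∈ R, ∀ w, G.Adj u w → h u ≠ h w
  ne_lower : ∀ u ∈ R, ∀ p, G.Adj u p → h p < h u → c u ≠ σ p
  upper_mem : ∀ u ∈ R, ∀ w, G.Adj u w → h u < h w → σ w = c u → w ∈ R
  ne : ∀ u ∈ R, ∀ w ∈ R, G.Adj u w → c u ≠ c w

theorem exists_forall_isRecolourableTo {f : V → α} (hj : IsRecolourableTo G h d f v j) :
    ∃ c : V → α, c v = j ∧
      ∀ u b, IsRecolourableTo G h d f u b → IsRecolourableTo G h d f u (c u) := by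
  classical
  have : Nonempty α := ⟨j⟩
  refine ⟨Function.update (fun u => Classical.epsilon (IsRecolourableTo G h d f u)) v j,
    Function.update_self .., fun u b hu => ?_⟩
  rcases eq_or_ne u v with rfl | huv
  · rwa [Function.update_self]
  · rw [Function.update_of_ne huv]
    exact Classical.epsilon_spec ⟨b, hu⟩

theorem exists_isRecolouringPlan (ht : IsTreeLevel G h v d) {σ : G.Coloring α}
    (hj : IsRecolourableTo G h d σ v j) :
    ∃ R c, IsRecolouringPlan G h σ R c ∧ v ∈ R ∧ c v = j ∧ ∀ u ∈ R, h u < d := by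
  obtain ⟨c, hcv, hc⟩ := exists_forall_isRecolourableTo hj
  let R : Set V := {u | Relation.ReflTransGen (fun u w => G.Adj u w ∧ h u < h w ∧ σ w = c u) v u}
  have hR : ∀ u ∈ R, IsRecolourableTo G h d σ u (c u) := by
    intro u hu
    induction hu with
    | refl => exact hc v j hj
    | tail _ hs ih => exact hc _ _ (ih.upper hs.1 hs.2.1 hs.2.2).choose_spec
  have hlevel : ∀ u ∈ R, ∀ w, G.Adj u w → h u ≠ h w := fun u hu w ha => by
    have := ht.adj u w ha (hR u hu).lt.le
    lia
  have hne : ∀ u, ∀ w ∈ R, G.Adj u w → h u < h w → c w ≠ c u := by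
    intro u w hw ha hlt
    rcases Relation.ReflTransGen.cases_tail hw with rfl | ⟨p, _, hpa, hpw, hσ⟩
    · have := (ht.eq_zero_iff w).2 rfl
      lia
    · rw [ht.lower_unique w u p (hR w hw).lt.le ha.symm hpa.symm hlt hpw, ← hσ]
      exact (hR w hw).ne
  refine ⟨R, c, ⟨hlevel, fun u hu => (hR u hu).ne_lower,
    fun u hu w ha hlt hσ => Relation.ReflTransGen.tail hu ⟨ha, hlt, hσ⟩, fun u hu w hw ha => ?_⟩,
    .refl, hcv, fun u hu => (hR u hu).lt⟩
  rcases (hlevel u hu w ha).lt_or_gt with hlt | hlt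
  · exact (hne u w hw ha hlt).symm
  · exact hne w u hu ha.symm hlt

variable [DecidableEq V] {σ : G.Coloring α} {R : Set V} {c : V → α}

theorem IsRecolouringPlan.piecewise_ne (hp : IsRecolouringPlan G h σ R c) {A : Finset V}
    (hAR : ∀ x ∈ A, x ∈ R) (hA : ∀ x ∈ A, ∀ y ∈ R, G.Adj x y → h x < h y → y ∈ A) {x y : V}
    (ha : G.Adj x y) : A.piecewise c σ x ≠ A.piecewise c σ y := by
  have hmixed : ∀ {x y}, G.Adj x y → x ∈ A → y ∉ A → c x ≠ σ y := by
    intro x y ha hx hy heq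
    rcases (hp.level_ne x (hAR x hx) y ha).lt_or_gt with hlt | hlt
    · exact hy (hA x hx y (hp.upper_mem x (hAR x hx) y ha hlt heq.symm) ha hlt)
    · exact hp.ne_lower x (hAR x hx) y ha hlt heq
  by_cases hx : x ∈ A <;> by_cases hy : y ∈ A <;>
    simp only [hx, hy, not_false_eq_true, piecewise_eq_of_mem, piecewise_eq_of_notMem]
  · exact hp.ne x (hAR x hx) y (hAR y hy) ha
  · exact hmixed ha hx hy
  · exact (hmixed ha.symm hy hx).symm
  · exact σ.valid ha

end Recolouring

section Reachability

variable {V : Type*} [Fintype V] {G : SimpleGraph V} {h : V → ℕ} {d k : ℕ} {v : V}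
  {σ : G.Coloring (Fin k)}

theorem reachable_of_eq_off_singleton {τ : G.Coloring (Fin k)} {a : V}
    (hστ : ∀ x, x ≠ a → σ x = τ x) : (colouringGraph G k 1).Reachable σ τ := by
  rcases eq_or_ne σ τ with rfl | hne
  · rfl
  · refine SimpleGraph.Adj.reachable ⟨hne, card_le_one.2 fun x hx y hy => ?_⟩
    rw [mem_filter_univ] at hx hy
    exact (not_imp_comm.1 (hστ x) hx).trans (not_imp_comm.1 (hστ y) hy).symm

theorem IsRecolouringPlan.exists_reachable [DecidableEq V] {R : Set V} {c : V → Fin k}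
    (hp : IsRecolouringPlan G h σ R c) {A : Finset V} (hAR : ∀ x ∈ A, x ∈ R)
    (hA : ∀ x ∈ A, ∀ y ∈ R, G.Adj x y → h x < h y → y ∈ A) :
    ∃ τ : G.Coloring (Fin k), ⇑τ = A.piecewise c σ ∧ (colouringGraph G k 1).Reachable σ τ := by
  induction A using Finset.induction_on_min_value h with
  | empty => exact ⟨σ, piecewise_empty .. |>.symm, .rfl⟩
  | insert a s ha hmin ih =>
    have hs : ∀ x ∈ s, ∀ y ∈ R, G.Adj x y → h x < h y → y ∈ s := by
      intro x hx y hy hxy hlt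
      refine mem_of_mem_insert_of_ne (hA x (mem_insert_of_mem hx) y hy hxy hlt) ?_
      rintro rfl
      exact (hmin x hx).not_gt hlt
    obtain ⟨τ, hτ, hreach⟩ := ih (fun x hx => hAR x (mem_insert_of_mem hx)) hs
    refine ⟨SimpleGraph.Coloring.mk _ (hp.piecewise_ne hAR hA), rfl,
      hreach.trans (reachable_of_eq_off_singleton (a := a) fun x hx => ?_)⟩
    rw [hτ]
    exact (piecewise_insert_of_ne _ _ _ hx).symm

theorem IsRecolourableTo.exists_reachable (ht : IsTreeLevel G h v d) {j : Fin k}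
    (hj : IsRecolourableTo G h d σ v j) :
    ∃ τ : G.Coloring (Fin k), τ v = j ∧ (∀ x, d ≤ h x → τ x = σ x) ∧
      (colouringGraph G k 1).Reachable σ τ := by
  classical
  obtain ⟨R, c, hp, hv, rfl, hd⟩ := exists_isRecolouringPlan ht hj
  obtain ⟨τ, hτ, hreach⟩ := hp.exists_reachable (A := R.toFinset) (fun x hx => by simpa using hx)
    (fun x _ y hy _ _ => by simpa using hy)
  refine ⟨τ, ?_, fun x hx => ?_, hreach⟩
  · simp [hτ, hv]
  · rw [hτ, piecewise_eq_of_notMem]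
    exact fun hxR => (hd x (by simpa using hxR)).not_ge hx

end Reachability

section FrozenCount

theorem choose_le_pow_of_exp_mul_le {n b : ℕ} {y : ℝ} (h : Real.exp 1 * n ≤ y * b) :
    (n.choose b : ℝ) ≤ y ^ b := by
  have hbb : (0 : ℝ) < (b : ℝ) ^ b := mod_cast Nat.pow_self_pos
  refine le_of_mul_le_mul_left ?_ hbb
  calc (b : ℝ) ^ b * n.choose b ≤ (b : ℝ) ^ b * ((n : ℝ) ^ b / b.factorial) := by
        gcongr
        exact Nat.choose_le_pow_div b n
    _ = (b : ℝ) ^ b / b.factorial * (n : ℝ) ^ b := by ring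
    _ ≤ Real.exp b * (n : ℝ) ^ b := by
        gcongr
        exact Real.pow_div_factorial_le_exp _ b.cast_nonneg b
    _ = (Real.exp 1 * n) ^ b := by rw [mul_pow, ← Real.exp_nat_mul, mul_one]
    _ ≤ (y * b) ^ b := by gcongr
    _ = (b : ℝ) ^ b * y ^ b := by rw [mul_pow, mul_comm]

variable {V α : Type*} {G : SimpleGraph V} {h : V → ℕ} {v u : V} {d : ℕ}

theorem IsTreeLevel.exists_forall_notMem_exists_isFrozen (ht : IsTreeLevel G h v d)
    {f : V → α} (hu : h u < d) (hf : IsFrozen G h d f u) :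
    ∃ S : Finset α, #S ≤ 2 ∧
      ∀ c ∉ S, ∃ w, G.Adj u w ∧ h w = h u + 1 ∧ f w = c ∧ IsFrozen G h d f w := by
  classical
  obtain ⟨S, hS, hfree⟩ : ∃ S : Finset α, #S ≤ 2 ∧
      ∀ c ∉ S, c ≠ f u ∧ ∀ p, G.Adj u p → h p < h u → c ≠ f p := by
    by_cases hp : ∃ p, G.Adj u p ∧ h p < h u
    · obtain ⟨p, hp, hpu⟩ := hp
      refine ⟨{f u, f p}, card_le_two, fun c hc => ?_⟩
      simp only [mem_insert, mem_singleton, not_or] at hc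
      refine ⟨hc.1, fun q hq hqu => ?_⟩
      rw [ht.lower_unique u q p hu.le hq hp hqu hpu]
      exact hc.2
    · push Not at hp
      exact ⟨{f u}, by simp, fun c hc =>
        ⟨by simpa using hc, fun p hpu hlt => absurd (hp p hpu) hlt.not_ge⟩⟩
  refine ⟨S, hS, fun c hc => ?_⟩
  by_contra! hw
  refine hf c (isRecolourableTo_of_forall_not_isFrozen hu (hfree c hc).1 (hfree c hc).2
    fun w ha hlt hwc => hw w ha ?_ hwc)
  have := ht.adj u w ha hu.le
  lia

variable [Fintype V] [DecidableEq V] [DecidableRel G.Adj] {ℓ y p : ℝ} {m D i r : ℕ}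

/-- The vertices of level `i + 1` adjacent to a vertex of `U`; when `U` lies on level `i`, these are
the children of the vertices of `U`. -/
def children (G : SimpleGraph V) [DecidableRel G.Adj] (h : V → ℕ) (i : ℕ) (U : Finset V) :
    Finset V :=
  U.biUnion fun u => {w | G.Adj u w ∧ h w = i + 1}

theorem card_children_le (hD : ∀ x, G.degree x ≤ D) (U : Finset V) :
    #(children G h i U) ≤ #U * D := by
  refine card_biUnion_le_card_mul _ _ _ fun u _ => (card_le_card fun w hw => ?_).trans (hD u)
  exact (G.mem_neighborFinset u w).2 ((mem_filter_univ _).1 hw).1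

open Classical in
theorem IsTreeLevel.mul_card_le_card_children [Fintype α] (ht : IsTreeLevel G h v d)
    (hm : m + 2 ≤ Fintype.card α) (hid : i < d) {U : Finset V} (hU : ∀ u ∈ U, h u = i) {f : V → α}
    (hf : ∀ u ∈ U, IsFrozen G h d f u) :
    m * #U ≤ #{w ∈ children G h i U | IsFrozen G h d f w} := by
  classical
  rw [children, filter_biUnion, card_biUnion]
  · rw [mul_comm, ← smul_eq_mul]
    refine card_nsmul_le_sum _ _ _ fun u hu => ?_
    obtain ⟨S, hS2, hS⟩ := ht.exists_forall_notMem_exists_isFrozen (by have := hU u hu; lia)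
      (hf u hu)
    have hSc : m ≤ #Sᶜ := by rw [card_compl]; lia
    refine hSc.trans ((card_le_card (t := image f _) fun c hc => ?_).trans card_image_le)
    obtain ⟨w, ha, hw, hwc, hfw⟩ := hS c (mem_compl.1 hc)
    exact mem_image.2 ⟨w, by simp [ha, hw, hfw, hU u hu], hwc⟩
  · intro u hu u' hu' hne
    refine disjoint_left.2 fun w hw hw' => hne ?_
    simp only [mem_filter, mem_univ, true_and] at hw hw'
    have := hU u hu
    have := hU u' hu'
    exact ht.lower_unique w u u' (by lia) hw.1.1.symm hw'.1.1.symm (by lia) (by lia)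

theorem choose_card_children_le (hD : ∀ x, G.degree x ≤ D) (hy : Real.exp 1 * D ≤ y * m)
    (U : Finset V) : ((#(children G h i U)).choose (m * #U) : ℝ) ≤ y ^ (m * #U) := by
  refine choose_le_pow_of_exp_mul_le ?_
  calc Real.exp 1 * #(children G h i U) ≤ Real.exp 1 * (#U * D) := by
        gcongr
        exact_mod_cast card_children_le hD U
    _ = Real.exp 1 * D * #U := by ring
    _ ≤ y * m * #U := by gcongr
    _ = y * (m * #U : ℕ) := by push_cast; ring

variable [Fintype α] [DecidableEq α]

open Classical in
/-- In a uniformly random proper colouring of `G` with colours from `α`, all vertices of a given set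
`U` of vertices of level `i` are frozen with probability at most `p ^ #U`. -/
def FrozenProbLE (G : SimpleGraph V) [DecidableRel G.Adj] (h : V → ℕ) (d : ℕ) (α : Type*)
    [Fintype α] [DecidableEq α] (i : ℕ) (p : ℝ) : Prop :=
  ∀ U : Finset V, (∀ u ∈ U, h u = i) →
    (#{f ∈ properOn G α univ | ∀ u ∈ U, IsFrozen G h d f u} : ℝ) ≤ p ^ #U * #(properOn G α univ)

theorem FrozenProbLE.mono (hp : FrozenProbLE G h d α i p) (hp0 : 0 ≤ p) {p' : ℝ} (hpp' : p ≤ p') :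
    FrozenProbLE G h d α i p' := fun U hU => (hp U hU).trans (by gcongr)

theorem IsTreeLevel.frozenProbLE_of_succ_eq [Nonempty α] (ht : IsTreeLevel G h v d)
    (hG : HasFreeColours G α ℓ) (hℓ : 0 < ℓ) (hid : i + 1 = d) :
    FrozenProbLE G h d α i (2 / ℓ) := by
  classical
  intro U hU
  let X : Finset V := {x | h x = d}
  have hUX {u x : V} (hu : u ∈ U) (hx : x ∈ X) : x ≠ u := by
    rintro rfl
    have := (mem_filter_univ _).1 hx
    have := hU x hu
    lia
  have hdep : DependsOn (fun f : V → α => ∀ u ∈ U, #(freeColours G X f u) ≤ 2)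
      (U : Set V)ᶜ := by
    intro f g hfg
    refine propext (forall₂_congr fun u _ => ?_)
    rw [freeColours_congr fun x hx _ => hfg x fun hxU => hUX hxU hx rfl]
  have hfew : ℓ ^ #U * #{f ∈ properOn G α univ | ∀ u ∈ U, #(freeColours G X f u) ≤ 2} ≤
      (2 : ℝ) ^ #U * #(properOn G α univ) := by
    have := pow_mul_card_properOn_union_le hℓ.le
      (hG.pow_mul_card_properOn_le hℓ.le disjoint_compl_right) disjoint_compl_right 2 hdep
      fun f hf u hu => (card_le_card <| freeColours_anti (fun x hx =>
        mem_compl.2 fun hxU => hUX hxU hx rfl) f u).trans (hf u hu)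
    rwa [union_compl] at this
  rw [div_pow, div_mul_eq_mul_div, le_div_iff₀' (by positivity)]
  refine le_trans ?_ hfew
  gcongr with f _ u hu
  intro hf
  have hud := hU u hu
  obtain ⟨S, hS2, hS⟩ := ht.exists_forall_notMem_exists_isFrozen (by lia) hf
  refine (card_le_card fun c hc => ?_).trans hS2
  by_contra hcS
  obtain ⟨w, ha, hw, hwc, -⟩ := hS c hcS
  exact mem_freeColours.1 hc w ((mem_filter_univ _).2 (by lia)) ha hwc

/-- If `U` is frozen then so are `m` children of each of its vertices, and there are at most
`y ^ (m * #U)` ways to choose `m * #U` of the children. -/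
theorem IsTreeLevel.frozenProbLE_of_succ (ht : IsTreeLevel G h v d) (hm : m + 2 ≤ Fintype.card α)
    (hD : ∀ x, G.degree x ≤ D) (hy : Real.exp 1 * D ≤ y * m) (hp : 0 ≤ p) (hid : i < d)
    (hfr : FrozenProbLE G h d α (i + 1) p) : FrozenProbLE G h d α i ((y * p) ^ m) := by
  classical
  intro U hU
  let 𝒜 := powersetCard (m * #U) (children G h i U)
  have hcover : {f ∈ properOn G α univ | ∀ u ∈ U, IsFrozen G h d f u} ⊆
      𝒜.biUnion fun A => {f ∈ properOn G α univ | ∀ w ∈ A, IsFrozen G h d f w} := by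
    intro f hf
    obtain ⟨hproper, hf⟩ := mem_filter.1 hf
    obtain ⟨A, hA, hAcard⟩ := exists_subset_card_eq (ht.mul_card_le_card_children hm hid hU hf)
    exact mem_biUnion.2 ⟨A, mem_powersetCard.2 ⟨hA.trans (filter_subset _ _), hAcard⟩,
      mem_filter.2 ⟨hproper, fun w hw => (mem_filter.1 (hA hw)).2⟩⟩
  have hA : ∀ A ∈ 𝒜, (#{f ∈ properOn G α univ | ∀ w ∈ A, IsFrozen G h d f w} : ℝ) ≤
      p ^ (m * #U) * #(properOn G α univ) := by
    intro A hA
    obtain ⟨hAC, hAcard⟩ := mem_powersetCard.1 hA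
    rw [← hAcard]
    refine hfr A fun w hw => ?_
    obtain ⟨u, _, hw⟩ := mem_biUnion.1 (hAC hw)
    exact ((mem_filter_univ _).1 hw).2
  calc (#{f ∈ properOn G α univ | ∀ u ∈ U, IsFrozen G h d f u} : ℝ)
      ≤ ∑ A ∈ 𝒜, (#{f ∈ properOn G α univ | ∀ w ∈ A, IsFrozen G h d f w} : ℝ) := by
        exact_mod_cast (card_le_card hcover).trans card_biUnion_le
    _ ≤ #𝒜 * (p ^ (m * #U) * #(properOn G α univ)) := by
        rw [← nsmul_eq_mul]
        exact sum_le_card_nsmul _ _ _ hA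
    _ ≤ y ^ (m * #U) * (p ^ (m * #U) * #(properOn G α univ)) := by
        rw [card_powersetCard]
        gcongr
        exact choose_card_children_le hD hy U
    _ = ((y * p) ^ m) ^ #U * #(properOn G α univ) := by rw [← pow_mul, mul_pow, mul_assoc]

theorem IsTreeLevel.frozenProbLE [Nonempty α] (ht : IsTreeLevel G h v d)
    (hG : HasFreeColours G α ℓ) (hℓ : 0 < ℓ) (hm : m + 2 ≤ Fintype.card α) (hm2 : 2 ≤ m)
    (hD : ∀ x, G.degree x ≤ D) (hy1 : 1 ≤ y) (hy : Real.exp 1 * D ≤ y * m)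
    (hyℓ : 2 * y ^ 2 / ℓ ≤ Real.exp (-1)) (hir : i + r + 1 = d) :
    FrozenProbLE G h d α i ((y ^ 2)⁻¹ * Real.exp (-m ^ r)) := by
  induction r generalizing i with
  | zero =>
    refine (ht.frozenProbLE_of_succ_eq hG hℓ hir).mono (by positivity) ?_
    rw [pow_zero, inv_mul_eq_div, le_div_iff₀' (by positivity)]
    exact (Eq.le (by ring)).trans hyℓ
  | succ r ih =>
    refine (ht.frozenProbLE_of_succ hm hD hy (by positivity) (by lia)
      (ih (i := i + 1) (by lia))).mono (by positivity) ?_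
    have hyinv : y * ((y ^ 2)⁻¹ * Real.exp (-m ^ r)) = y⁻¹ * Real.exp (-m ^ r) := by
      field_simp
    have hexp : Real.exp (-m ^ r) ^ m = Real.exp (-m ^ (r + 1)) := by
      rw [← Real.exp_nat_mul, pow_succ', mul_neg]
    rw [hyinv, mul_pow, hexp, ← inv_pow]
    refine mul_le_mul_of_nonneg_right ?_ (Real.exp_pos _).le
    exact pow_le_pow_of_le_one (by positivity) (inv_le_one_of_one_le₀ hy1) hm2

/-- Some neighbour `u` of some vertex `v` is frozen with respect to the distance from `v`. -/
def HasFrozenNeighbour (G : SimpleGraph V) (d : ℕ) (f : V → α) : Prop :=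
  ∃ v u, G.Adj v u ∧ IsFrozen G (level G d v) d f u

theorem card_filter_isFrozen_le [Nonempty α] (hG : HasFreeColours G α ℓ) (hℓ : 0 < ℓ)
    (hm : m + 2 ≤ Fintype.card α) (hm2 : 2 ≤ m) (hD : ∀ x, G.degree x ≤ D) (hy1 : 1 ≤ y)
    (hy : Real.exp 1 * D ≤ y * m) (hyℓ : 2 * y ^ 2 / ℓ ≤ Real.exp (-1))
    (hg : ((2 * (r + 2) + 2 : ℕ) : ℕ∞) < G.egirth) (hvu : G.Adj v u)
    [DecidablePred fun f : V → α => IsFrozen G (level G (r + 2) v) (r + 2) f u] :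
    (#{f ∈ properOn G α univ | IsFrozen G (level G (r + 2) v) (r + 2) f u} : ℝ) ≤
      Real.exp (-m ^ r) * #(properOn G α univ) := by
  classical
  have ht := isTreeLevel_level hg v
  have hu : level G (r + 2) v u = 1 := by
    have := (ht.eq_zero_iff v).2 rfl
    have := ht.adj v u hvu (by lia)
    lia
  have hfr := ht.frozenProbLE hG hℓ hm hm2 hD hy1 hy hyℓ (i := 1) (r := r) (by lia) {u} (by simpa)
  simp only [mem_singleton, forall_eq, card_singleton, pow_one] at hfr
  calc (#{f ∈ properOn G α univ | IsFrozen G (level G (r + 2) v) (r + 2) f u} : ℝ)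
      ≤ (y ^ 2)⁻¹ * Real.exp (-m ^ r) * #(properOn G α univ) := by convert hfr
    _ ≤ Real.exp (-m ^ r) * #(properOn G α univ) := by
        gcongr
        exact mul_le_of_le_one_left (Real.exp_pos _).le
          (inv_le_one_of_one_le₀ (one_le_pow₀ hy1))

open Classical in
theorem card_filter_hasFrozenNeighbour_le [Nonempty α] (hG : HasFreeColours G α ℓ) (hℓ : 0 < ℓ)
    (hm : m + 2 ≤ Fintype.card α) (hm2 : 2 ≤ m) (hD : ∀ x, G.degree x ≤ D) (hy1 : 1 ≤ y)
    (hy : Real.exp 1 * D ≤ y * m) (hyℓ : 2 * y ^ 2 / ℓ ≤ Real.exp (-1))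
    (hg : ((2 * (r + 2) + 2 : ℕ) : ℕ∞) < G.egirth) :
    (#{f ∈ properOn G α univ | HasFrozenNeighbour G (r + 2) f} : ℝ) ≤
      Fintype.card V * D * Real.exp (-m ^ r) * #(properOn G α univ) := by
  let F (v u : V) : Finset (V → α) :=
    {f ∈ properOn G α univ | IsFrozen G (level G (r + 2) v) (r + 2) f u}
  have hcover : {f ∈ properOn G α univ | HasFrozenNeighbour G (r + 2) f} ⊆
      univ.biUnion fun v => (G.neighborFinset v).biUnion (F v) := by
    intro f hf
    obtain ⟨hproper, v, u, hvu, hfr⟩ := mem_filter.1 hf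
    exact mem_biUnion.2 ⟨v, mem_univ v, mem_biUnion.2
      ⟨u, (G.mem_neighborFinset v u).2 hvu, mem_filter.2 ⟨hproper, hfr⟩⟩⟩
  calc (#{f ∈ properOn G α univ | HasFrozenNeighbour G (r + 2) f} : ℝ)
      ≤ ∑ v, ∑ u ∈ G.neighborFinset v, (#(F v u) : ℝ) := by
        exact_mod_cast (card_le_card hcover).trans
          (card_biUnion_le.trans (sum_le_sum fun v _ => card_biUnion_le))
    _ ≤ ∑ v, ∑ _u ∈ G.neighborFinset v, Real.exp (-m ^ r) * #(properOn G α univ) := by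
        exact sum_le_sum fun v _ => sum_le_sum fun u hu =>
          card_filter_isFrozen_le hG hℓ hm hm2 hD hy1 hy hyℓ hg ((G.mem_neighborFinset v u).1 hu)
    _ ≤ ∑ _v : V, D * (Real.exp (-m ^ r) * #(properOn G α univ)) := by
        refine sum_le_sum fun v _ => ?_
        rw [sum_const, nsmul_eq_mul]
        gcongr
        exact hD v
    _ = Fintype.card V * D * Real.exp (-m ^ r) * #(properOn G α univ) := by
        rw [sum_const, nsmul_eq_mul, card_univ]
        ring

end FrozenCount

section LooseAndThawed

variable {V : Type*} {G : SimpleGraph V} {d k t D : ℕ} {σ τ : G.Coloring (Fin k)} {v : V}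
  {j : Fin k}

theorem isRecolourableTo_of_not_hasFrozenNeighbour (hd : 0 < d) (hσ : ¬ HasFrozenNeighbour G d σ)
    (hj : j ≠ σ v) : IsRecolourableTo G (level G d v) d σ v j := by
  have hv : level G d v v = 0 := level_eq_zero_iff.2 rfl
  exact isRecolourableTo_of_forall_not_isFrozen (by lia) hj (fun p _ hp => by lia)
    fun w hvw _ _ hw => hσ ⟨v, w, hvw, hw⟩

variable [Fintype V]

theorem isThawed_of_not_hasFrozenNeighbour (hd : 0 < d) (hg : ((2 * d + 2 : ℕ) : ℕ∞) < G.egirth)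
    (hσ : ¬ HasFrozenNeighbour G d σ) (v : V) : IsThawed σ v := by
  intro j
  rcases eq_or_ne j (σ v) with rfl | hj
  · exact ⟨σ, .refl σ, rfl⟩
  · have hrec := isRecolourableTo_of_not_hasFrozenNeighbour hd hσ hj
    obtain ⟨τ, hτv, -, hτ⟩ := hrec.exists_reachable (isTreeLevel_level hg v)
    exact ⟨τ, hτ, hτv⟩

variable [DecidableRel G.Adj]

theorem IsTreeLevel.hammingDist_le {h : V → ℕ} (ht : IsTreeLevel G h v d)
    (hD : ∀ x, G.degree x ≤ D) (hτ : ∀ x, d ≤ h x → τ x = σ x) :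
    hammingDist (fun x => σ x) (fun x => τ x) ≤ (D + 1) ^ d := by
  refine (card_le_card fun x hx => ?_).trans (ht.card_le hD le_rfl)
  rw [mem_filter_univ] at hx ⊢
  by_contra! hdx
  exact hx (hτ x hdx.le).symm

theorem exists_colouringGraph_adj (hd : 0 < d) (hg : ((2 * d + 2 : ℕ) : ℕ∞) < G.egirth)
    (hD : ∀ x, G.degree x ≤ D) (ht : (D + 1) ^ d ≤ t) (hσ : ¬ HasFrozenNeighbour G d σ)
    (hj : j ≠ σ v) :
    ∃ τ, (colouringGraph G k t).Adj σ τ ∧ τ v = j ∧ ∀ x, d ≤ level G d v x → τ x = σ x := by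
  have htree := isTreeLevel_level hg v
  obtain ⟨τ, hτv, hτ, -⟩ :=
    (isRecolourableTo_of_not_hasFrozenNeighbour hd hσ hj).exists_reachable htree
  refine ⟨τ, ⟨?_, (htree.hammingDist_le hD hτ).trans ht⟩, hτv, hτ⟩
  rintro rfl
  exact hj hτv.symm

theorem isLoose_of_not_hasFrozenNeighbour (hd : 0 < d) (hk : 2 ≤ k)
    (hg : ((2 * d + 2 : ℕ) : ℕ∞) < G.egirth) (hD : ∀ x, G.degree x ≤ D) (ht : (D + 1) ^ d ≤ t)
    (htV : t < Fintype.card V) (hσ : ¬ HasFrozenNeighbour G d σ) (v : V) : IsLoose t σ v := by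
  intro j
  rcases ne_or_eq j (σ v) with hj | rfl
  · obtain ⟨τ, hστ, hτv, -⟩ := exists_colouringGraph_adj hd hg hD ht hσ hj
    exact ⟨τ, hστ, hτv⟩
  -- A neighbour of `σ` in which `v` keeps its colour is found by recolouring a vertex far from `v`.
  · obtain ⟨u, hu⟩ : ∃ u, d < level G d v u := by
      by_contra! hall
      have hball := ((isTreeLevel_level hg v).card_le hD le_rfl).trans ht
      rw [filter_true_of_mem fun x _ => hall x, card_univ] at hball
      exact hball.not_gt htV
    have : Nontrivial (Fin k) := Fin.nontrivial_iff_two_le.2 hk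
    obtain ⟨j, hj⟩ := exists_ne (σ u)
    obtain ⟨τ, hστ, -, hτ⟩ := exists_colouringGraph_adj hd hg hD ht hσ hj
    exact ⟨τ, hστ, hτ v (level_comm d v u ▸ hu.le)⟩

end LooseAndThawed

section UniformColouring

variable {V : Type*} [Fintype V] [DecidableEq V] {k : ℕ} {G : SimpleGraph V} [DecidableRel G.Adj]

/-- Proper colourings of `G`, as homomorphisms to the complete graph and as functions in
`properOn G α univ`. -/
def coloringEquivProperOn (G : SimpleGraph V) [DecidableRel G.Adj] (α : Type*) [Fintype α]
    [DecidableEq α] : G.Coloring α ≃ properOn G α univ where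
  toFun σ := ⟨σ, mem_properOn.2 fun _ _ _ _ ha => σ.valid ha⟩
  invFun f := SimpleGraph.Coloring.mk f.1 fun {x y} ha =>
    mem_properOn.1 f.2 x (mem_univ x) y (mem_univ y) ha

theorem one_sub_le_colouringProb {P : G.Coloring (Fin k) → Prop} {bad : (V → Fin k) → Prop}
    [DecidablePred bad] (hP : ∀ σ : G.Coloring (Fin k), ¬ bad σ → P σ)
    (hpos : 0 < #(properOn G (Fin k) univ)) {δ : ℝ}
    (hbad : (#{f ∈ properOn G (Fin k) univ | bad f} : ℝ) ≤ δ * #(properOn G (Fin k) univ)) :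
    1 - δ ≤ colouringProb G k P := by
  have hcard : Nat.card (G.Coloring (Fin k)) = #(properOn G (Fin k) univ) := by
    rw [Nat.card_congr (coloringEquivProperOn G (Fin k)), Nat.card_eq_fintype_card,
      Fintype.card_coe]
  have : Finite (G.Coloring (Fin k)) := Finite.of_equiv _ (coloringEquivProperOn G (Fin k)).symm
  have hgood : #{f ∈ properOn G (Fin k) univ | ¬ bad f} ≤
      Nat.card {σ : G.Coloring (Fin k) // P σ} := by
    rw [← Fintype.card_coe, ← Nat.card_eq_fintype_card]
    refine Nat.card_le_card_of_injective (fun f =>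
      ⟨(coloringEquivProperOn G (Fin k)).symm ⟨f.1, (mem_filter.1 f.2).1⟩,
        hP _ (mem_filter.1 f.2).2⟩) fun f g hfg => ?_
    have := (coloringEquivProperOn G (Fin k)).symm.injective (congrArg Subtype.val hfg)
    exact Subtype.ext (Subtype.mk.inj this)
  have hsplit := card_filter_add_card_filter_not (s := properOn G (Fin k) univ) bad
  rw [colouringProb, hcard, le_div_iff₀ (by exact_mod_cast hpos)]
  rify at hgood hsplit
  linarith

theorem one_sub_le_colouringProb_isLoose_and_isThawed {ℓ y : ℝ} {D r t : ℕ} (hk : 4 ≤ k)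
    (hG : HasFreeColours G (Fin k) ℓ) (hℓ : 0 < ℓ) (hD : ∀ x, G.degree x ≤ D) (hy1 : 1 ≤ y)
    (hy : Real.exp 1 * D ≤ y * (k - 2 : ℕ)) (hyℓ : 2 * y ^ 2 / ℓ ≤ Real.exp (-1))
    (hg : ((2 * (r + 2) + 2 : ℕ) : ℕ∞) < G.egirth) (ht : (D + 1) ^ (r + 2) ≤ t)
    (htV : t < Fintype.card V) :
    1 - Fintype.card V * D * Real.exp (-((k - 2 : ℕ) : ℝ) ^ r) ≤
      colouringProb G k fun σ => ∀ v, IsLoose t σ v ∧ IsThawed σ v := by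
  classical
  have : Nonempty (Fin k) := ⟨⟨0, by lia⟩⟩
  have hfrozen := card_filter_hasFrozenNeighbour_le hG hℓ (m := k - 2)
    (by rw [Fintype.card_fin]; lia) (by lia) hD hy1 hy hyℓ hg
  refine one_sub_le_colouringProb (fun σ hσ v => ⟨?_, ?_⟩) (hG.card_properOn_pos hℓ univ) hfrozen
  · exact isLoose_of_not_hasFrozenNeighbour (by lia) (by lia) hg hD ht htV hσ v
  · exact isThawed_of_not_hasFrozenNeighbour (by lia) hg hσ v

end UniformColouring

section Depth

open Filter

theorem exists_depth {m : ℕ} (hm : 4 ≤ Real.log m) :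
    ∀ᶠ n : ℕ in atTop, ∃ r : ℕ, 2 * Real.log n ≤ (m : ℝ) ^ r ∧
      (m : ℝ) ^ r ≤ 2 * m * Real.log n ∧ 2 * (r + 2) + 2 < ⌈Real.log (Real.log n)⌉₊ := by
  have hm1 : (1 : ℝ) < m := (Real.log_pos_iff (by positivity)).1 (by linarith)
  have hloglog := Real.tendsto_log_atTop.comp
    (Real.tendsto_log_atTop.comp (tendsto_natCast_atTop_atTop (R := ℝ)))
  have hlog := Real.tendsto_log_atTop.comp (tendsto_natCast_atTop_atTop (R := ℝ))
  filter_upwards [hloglog.eventually_ge_atTop 20, hlog.eventually_ge_atTop 1] with n hll hl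
  simp only [Function.comp_apply] at hll hl
  obtain ⟨p, hle, hlt⟩ := exists_nat_pow_near (by linarith : 1 ≤ 2 * Real.log n) hm1
  have hp : 4 * (p : ℝ) ≤ 1 + Real.log (Real.log n) := by
    calc 4 * (p : ℝ) ≤ p * Real.log m := by rw [mul_comm]; gcongr
      _ = Real.log ((m : ℝ) ^ p) := by rw [Real.log_pow]
      _ ≤ Real.log (2 * Real.log n) := Real.log_le_log (by positivity) hle
      _ = Real.log 2 + Real.log (Real.log n) := Real.log_mul two_ne_zero (by linarith)
      _ ≤ 1 + Real.log (Real.log n) := by linarith [Real.log_two_lt_d9]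
  refine ⟨p + 1, hlt.le, ?_, ?_⟩
  · rw [pow_succ]
    nlinarith
  · rw [Nat.lt_ceil]
    push_cast
    linarith

theorem pow_le_floor_mul_sq {m D r : ℕ} {C L : ℝ} (hD : (D + 1) ^ 2 ≤ m ^ 3)
    (hr : (m : ℝ) ^ r ≤ 2 * m * L) (hL : 0 ≤ L) (hC : 0 ≤ C) (hm : 8 * (m : ℝ) ^ 9 ≤ C ^ 2 * L) :
    (D + 1) ^ (r + 2) ≤ ⌊C * L ^ 2⌋₊ := by
  refine Nat.le_floor (le_of_sq_le_sq ?_ (by positivity))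
  push_cast
  rify at hD
  calc (((D : ℝ) + 1) ^ (r + 2)) ^ 2 = (((D : ℝ) + 1) ^ 2) ^ (r + 2) := pow_right_comm _ _ _
    _ ≤ ((m : ℝ) ^ 3) ^ (r + 2) := by gcongr
    _ = ((m : ℝ) ^ r) ^ 3 * m ^ 6 := by ring
    _ ≤ (2 * m * L) ^ 3 * m ^ 6 := by gcongr
    _ = 8 * (m : ℝ) ^ 9 * L ^ 3 := by ring
    _ ≤ C ^ 2 * L * L ^ 3 := by gcongr
    _ = (C * L ^ 2) ^ 2 := by ring

theorem mul_mul_exp_neg_pow_le {n m r D : ℕ} {δ : ℝ} (hn : 0 < n) (hD : (D : ℝ) ≤ δ * n)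
    (hr : 2 * Real.log n ≤ (m : ℝ) ^ r) : n * D * Real.exp (-(m : ℝ) ^ r) ≤ δ := by
  have hn0 : (0 : ℝ) < n := by exact_mod_cast hn
  have hδn : 0 ≤ δ * n := D.cast_nonneg.trans hD
  calc n * D * Real.exp (-(m : ℝ) ^ r) ≤ n * (δ * n) * Real.exp (-(2 * Real.log n)) := by gcongr
    _ = δ := by
      rw [Real.exp_neg, two_mul, Real.exp_add, Real.exp_log hn0]
      field_simp

theorem eventually_exists_depth {m D : ℕ} (hm : 4 ≤ Real.log m) (hD : (D + 1) ^ 2 ≤ m ^ 3)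
    {C δ : ℝ} (hC : 0 < C) (hδ : 0 < δ) :
    ∀ᶠ n : ℕ in atTop, ∃ r : ℕ, 2 * (r + 2) + 2 < ⌈Real.log (Real.log n)⌉₊ ∧
      (D + 1) ^ (r + 2) ≤ ⌊C * Real.log n ^ 2⌋₊ ∧ ⌊C * Real.log n ^ 2⌋₊ < n ∧
      n * D * Real.exp (-(m : ℝ) ^ r) ≤ δ := by
  have hcast := tendsto_natCast_atTop_atTop (R := ℝ)
  filter_upwards [exists_depth hm, eventually_gt_atTop 0,
    (Real.tendsto_log_atTop.comp hcast).eventually_ge_atTop (8 * (m : ℝ) ^ 9 / C ^ 2),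
    eventually_log_pow_le_rpow 2 (c := 1 / (2 * C)) (by positivity) one_pos,
    hcast.eventually_ge_atTop (D / δ)] with n ⟨r, hr, hr', hgirth⟩ hn hlog hlog2 hDn
  have hn0 : (0 : ℝ) < n := mod_cast hn
  rw [Function.comp_apply, div_le_iff₀' (by positivity)] at hlog
  rw [div_le_iff₀' hδ] at hDn
  rw [Real.rpow_one, div_mul_eq_mul_div, le_div_iff₀ (by positivity)] at hlog2
  refine ⟨r, hgirth, pow_le_floor_mul_sq hD hr' (Real.log_natCast_nonneg n) hC.le hlog,
    ?_, mul_mul_exp_neg_pow_le hn hDn hr⟩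
  rw [Nat.floor_lt (by positivity)]
  linarith

end Depth

section Parameters

open Filter

theorem eventually_sq_log_div_rpow_le {s : ℝ} (hs : 0 < s) :
    ∀ᶠ k : ℕ in atTop, 2 * (6 * Real.log k) ^ 2 / (k : ℝ) ^ s ≤ Real.exp (-1) := by
  filter_upwards [eventually_log_pow_le_rpow 2 (c := Real.exp (-1) / 72) (by positivity) hs,
    eventually_gt_atTop 0] with k hlog hk
  rw [div_le_iff₀ (by positivity)]
  linarith

theorem eventually_forall_degree_le : ∀ᶠ k : ℕ in atTop, ∀ D : ℕ, (D : ℝ) ≤ k * Real.log k →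
    Real.exp 1 * D ≤ 6 * Real.log k * (k - 2 : ℕ) ∧ (D + 1) ^ 2 ≤ (k - 2) ^ 3 := by
  filter_upwards [eventually_log_pow_le_rpow 2 (c := 1 / 32) (by positivity) one_pos,
    eventually_ge_atTop 4] with k hlog2 hk D hD
  rw [Real.rpow_one] at hlog2
  have hk4 : (4 : ℝ) ≤ k := mod_cast hk
  have hlog : 1 ≤ Real.log k := by
    rw [Real.le_log_iff_exp_le (by linarith)]
    linarith [Real.exp_one_lt_three]
  have hsub : ((k - 2 : ℕ) : ℝ) = k - 2 := by push_cast [show 2 ≤ k by lia]; rfl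
  refine ⟨?_, ?_⟩
  · rw [hsub]
    calc Real.exp 1 * D ≤ 3 * (k * Real.log k) := by
          gcongr
          exact Real.exp_one_lt_three.le
      _ ≤ 6 * Real.log k * (k - 2) := by nlinarith
  · rify
    rw [hsub]
    calc ((D : ℝ) + 1) ^ 2 ≤ (2 * (k * Real.log k)) ^ 2 := by
          gcongr
          nlinarith
      _ = 4 * (k : ℝ) ^ 2 * Real.log k ^ 2 := by ring
      _ ≤ 4 * (k : ℝ) ^ 2 * (1 / 32 * k) := by gcongr
      _ = (k / 2 : ℝ) ^ 3 := by ring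
      _ ≤ (k - 2 : ℝ) ^ 3 := by gcongr; linarith

theorem eventually_le_log_sub (c : ℝ) (i : ℕ) :
    ∀ᶠ k : ℕ in atTop, c ≤ Real.log (k - i : ℕ) :=
  (Real.tendsto_log_atTop.comp (tendsto_natCast_atTop_atTop.comp
    (tendsto_sub_atTop_nat i))).eventually_ge_atTop c

end Parameters

theorem mainTheorem4_general {ε : ℝ} (hε : 0 < ε) : ∃ k₀ : ℕ, ∀ k : ℕ, k₀ ≤ k →
    ∀ Δ : ℕ, (Δ : ℝ) ≤ (1 - ε) * k * Real.log k → ∀ C : ℝ, 0 < C → ∀ δ : ℝ, 0 < δ →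
      ∃ N : ℕ, ∀ n : ℕ, N ≤ n → ∀ (V : Type*) [Fintype V], Fintype.card V = n →
        ∀ (G : SimpleGraph V) [DecidableRel G.Adj], G.maxDegree ≤ Δ →
          (⌈Real.log (Real.log n)⌉₊ : ℕ∞) ≤ G.egirth →
          1 - δ ≤ colouringProb G k fun σ => ∀ v : V,
            IsLoose ⌊C * Real.log n ^ 2⌋₊ σ v ∧ IsThawed σ v := by
  classical
  obtain ⟨k₀, hk₀⟩ := Filter.eventually_atTop.1 <| (eventually_hasFreeColours hε).and <|
    eventually_forall_degree_le.and <| (eventually_le_log_sub 4 2).and <|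
    (eventually_sq_log_div_rpow_le (s := ε / 4) (by positivity)).and <| Filter.eventually_ge_atTop 4
  refine ⟨k₀, fun k hk Δ hΔ C hC δ hδ => ?_⟩
  obtain ⟨hfree, hdegree, hlogm, hyℓ, hk4⟩ := hk₀ k hk
  have hlog : Real.log (k - 2 : ℕ) ≤ Real.log k :=
    Real.log_le_log (mod_cast (by lia : 0 < k - 2)) (mod_cast k.sub_le 2)
  have hΔk : (Δ : ℝ) ≤ k * Real.log k := hΔ.trans <| by
    rw [mul_assoc]
    exact mul_le_of_le_one_left (by positivity) (by linarith)
  obtain ⟨hy, hm⟩ := hdegree Δ hΔk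
  obtain ⟨N, hN⟩ := Filter.eventually_atTop.1 (eventually_exists_depth hlogm hm hC hδ)
  refine ⟨N, fun n hn V _ hV G _ hmax hgirth => ?_⟩
  subst hV
  obtain ⟨r, hr, hball, hlt, hprob⟩ := hN _ hn
  have hdeg : ∀ v, G.degree v ≤ Δ := fun v => (G.degree_le_maxDegree v).trans hmax
  have hg : ((2 * (r + 2) + 2 : ℕ) : ℕ∞) < G.egirth := (Nat.cast_lt.2 hr).trans_le hgirth
  have hclique : G.CliqueFree 3 := cliqueFree_three_of_lt_egirth <| hg.trans_le' (by norm_cast; lia)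
  exact (sub_le_sub_left hprob 1).trans <| one_sub_le_colouringProb_isLoose_and_isThawed hk4
    (hfree Δ hΔ G hclique hdeg) (by positivity) hdeg (by linarith) hy hyℓ hg hball hlt

theorem mainTheorem4 :
    ∃ C : ℝ, 0 < C ∧ ∀ ε : ℝ, 0 < ε → ∃ k₀ : ℕ, ∀ k : ℕ, k₀ ≤ k →
      ∀ Δ : ℕ, (Δ : ℝ) ≤ (1 - ε) * k * Real.log k →
        ∀ δ : ℝ, 0 < δ → ∃ N : ℕ, ∀ n : ℕ, N ≤ n →
          ∀ (G : SimpleGraph (Fin n)) [DecidableRel G.Adj],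
            G.maxDegree ≤ Δ →
            (⌈Real.log (Real.log n)⌉₊ : ℕ∞) ≤ G.egirth →
            1 - δ ≤ colouringProb G k (fun σ => ∀ v : Fin n,
              IsLoose ⌊C * (Real.log n) ^ 2⌋₊ σ v ∧ IsThawed σ v) :=
  ⟨1, one_pos, fun _ hε => (mainTheorem4_general hε).imp fun _ hk₀ k hk Δ hΔ δ hδ =>
    (hk₀ k hk Δ hΔ 1 one_pos δ hδ).imp fun _ hN n hn => hN n hn (Fin n) (Fintype.card_fin n)⟩
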